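/- Let $d\ge 0$, let $K\subset\mathbb R^d$ be compact, and let $F$ be a finite-dimensional real normed space (for example $F=\mathbb R$ or $F=\mathbb R^k$). Let $f:K\to F$ be a $C^1$ function on $K$ with derivative $f'$; that is, $f':K\to L(\mathbb R^d,F)$ is continuous and for every $x\in K$ one has $f(y)=f(x)+f'(x)(y-x)+o(|y-x|)$ as $y\to x$ with $y\in K$. (In particular, $f$ may be the restriction to $K$ of a $C^1$ function on an open neighbourhood of $K$, with $f'$ its usual derivative.) Let $\sigma$ be the ReLU activation $\sigma(t)=\max(t,0)$, or a leaky ReLU activation, $\sigma(t)=t$ for $t\ge 0$ and $\sigma(t)=\alpha t$ for $t<0$, with $0<\alpha<1$. Then for every $\varepsilon>0$ there is a neural network with a single hidden layer and activation $\sigma$, $$g(x)=\sum_{i=1}^m \sigma(\langle w_i,x\rangle+b_i)\,a_i+c,\qquad w_i\in\mathbb R^d,\ b_i\in\mathbb R,\ a_i,c\in F,$$ such that $g$ is differentiable at Lebesgue-almost every point of $\mathbb R^d$, and 1. $\|f(x)-g(x)\|<\varepsilon$ for every $x\in K$; 2. $\|f'(x)-Dg(x)\|<\varepsilon$ (operator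 norm) for every $x\in K$ at which $g$ is differentiable; 3. $g$ approximates $f$ up to $\varepsilon$ in the first order Sobolev norm on $K$: for every $p\in[1,\infty]$, $$\|f-g\|_{L^p(K)}+\|f'-Dg\|_{L^p(K)}<\varepsilon ,$$ where $L^p(K)$ is taken with respect to Lebesgue measure on $K$. -/

import Mathlib

open MeasureTheory
open scoped ENNReal

noncomputable section

/-- The ReLU activation `t ↦ max t 0`. -/
def relu (t : ℝ) : ℝ := max t 0

/-- The leaky ReLU activation with slope `α` on the negative half-line. -/
def leakyRelu (α t : ℝ) : ℝ := if 0 ≤ t then t else α * t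

/-- `σ` is the ReLU or a leaky ReLU (with some slope `0 < α < 1`). -/
def IsReluOrLeakyRelu (σ : ℝ → ℝ) : Prop :=
  σ = relu ∨ ∃ α : ℝ, 0 < α ∧ α < 1 ∧ σ = leakyRelu α

/-- The parameters of a neural network with inputs in `ℝ^d`, a single hidden layer of
`width` units, and a linear output layer with values in `F`
(`F = ℝ` for a scalar output, `F = ℝ^k` for `k` output units). -/
structure ShallowNet (d : ℕ) (F : Type*) where
  /-- number of hidden units -/
  width : ℕ
  /-- input weights of the hidden units -/
  weight : Fin width → EuclideanSpace ℝ (Fin d)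
  /-- biases of the hidden units -/
  bias : Fin width → ℝ
  /-- output weights of the hidden units -/
  out : Fin width → F
  /-- output bias -/
  outBias : F

/-- The function computed by the network with activation `σ`:
`x ↦ ∑ i, σ (⟪w i, x⟫ + b i) • a i + c`. -/
def ShallowNet.eval {d : ℕ} {F : Type*} [NormedAddCommGroup F] [NormedSpace ℝ F]
    (N : ShallowNet d F) (σ : ℝ → ℝ) (x : EuclideanSpace ℝ (Fin d)) : F :=
  ∑ i, σ (inner ℝ (N.weight i) x + N.bias i) • N.out i + N.outBias

/-- `f` is a `C^1` function on the set `K` with derivative `f'`: at every point of `K` it is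
differentiable along `K` with derivative `f' x`, and `f'` is continuous on `K`. (If `f` is `C^1`
on an open neighbourhood of `K` then this holds with `f'` the usual derivative.) -/
structure IsC1OnWith {d : ℕ} {F : Type*} [NormedAddCommGroup F] [NormedSpace ℝ F]
    (K : Set (EuclideanSpace ℝ (Fin d))) (f : EuclideanSpace ℝ (Fin d) → F)
    (f' : EuclideanSpace ℝ (Fin d) → EuclideanSpace ℝ (Fin d) →L[ℝ] F) : Prop where
  hasFDerivWithinAt : ∀ x ∈ K, HasFDerivWithinAt f (f' x) K x
  continuousOn : ContinuousOn f' K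

/-- The distance in the first order Sobolev space over `K` with exponent `p`, between functions
`f`, `g` with derivatives `f'`, `g'`: `‖f - g‖_{L^p(K)} + ‖f' - g'‖_{L^p(K)}`. -/
def sobolevDist {d : ℕ} {F : Type*} [NormedAddCommGroup F] [NormedSpace ℝ F]
    (p : ℝ≥0∞) (K : Set (EuclideanSpace ℝ (Fin d)))
    (f : EuclideanSpace ℝ (Fin d) → F)
    (f' : EuclideanSpace ℝ (Fin d) → EuclideanSpace ℝ (Fin d) →L[ℝ] F)
    (g : EuclideanSpace ℝ (Fin d) → F)
    (g' : EuclideanSpace ℝ (Fin d) → EuclideanSpace ℝ (Fin d) →L[ℝ] F) : ℝ≥0∞ :=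
  eLpNorm (fun x => f x - g x) p (volume.restrict K) +
    eLpNorm (fun x => f' x - g' x) p (volume.restrict K)

end

/-! The hypothesis on `f` is pointwise along `K` and weaker than Whitney's condition, so `f` need
not extend to a `C^1` function near `K` and cannot simply be mollified. It is first replaced by a
nearby `g` whose increments at small scales are uniformly governed by the derivative.

Extend `f` and `f'` continuously to `φ` and `A`. In a thin neighbourhood of `K`, let `g y` be the
infimum, over fine chains ending at `y`, of `φ` at the start plus the Riemann sum of `A` plus `ε`
times the length. Adding a step to a chain bounds the increments of `g` from above; reversing the
step bounds them from below. Trivial chains give `g ≤ φ`. The bound `φ - ε ≤ g` is a fundamental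
theorem of calculus along chains (`exists_abs_sub_chainSum_le`): by compactness, finer and finer
chains near `K` converge to a Lipschitz curve in `K`, along which `φ` is the integral of `A`. All
this is `exists_locally_almost_linear_near`.

Now `g` extends to a compactly supported Lipschitz `G`, and averaging `G` against a bump `θ` keeps
the estimates. A uniformly small change of `θ` changes `θ * G` little in the Lipschitz seminorm,
since the differences fall on `G`. By Stone-Weierstrass `θ` may thus be replaced by a sum of
exponentials `exp ⟪w, x⟫`; the convolution is again such a sum, and each exponential is a function
of one variable, approximated in Lipschitz seminorm by a piecewise linear one, hence by a network. A
local Lipschitz bound on the error at a point bounds the derivative error there. -/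

open Filter Topology Metric

/-! ### Chains of points and the functions they generate -/

section Chains

variable {E : Type*} [NormedAddCommGroup E]

/-- The length of the chain `x 0, …, x m`. -/
def chainLength (x : ℕ → E) (m : ℕ) : ℝ := ∑ i ∈ Finset.range m, dist (x i) (x (i + 1))

/-- `x 0, …, x m` is a chain in `U` with steps of size at most `δ`. -/
structure IsChainIn (U : Set E) (δ : ℝ) (x : ℕ → E) (m : ℕ) : Prop where
  mem : ∀ i ≤ m, x i ∈ U
  step : ∀ i < m, dist (x i) (x (i + 1)) ≤ δ

lemma chainLength_zero (x : ℕ → E) : chainLength x 0 = 0 := by simp [chainLength]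

lemma chainLength_succ (x : ℕ → E) (m : ℕ) :
    chainLength x (m + 1) = chainLength x m + dist (x m) (x (m + 1)) := by
  simp [chainLength, Finset.sum_range_succ]

lemma chainLength_add (x : ℕ → E) (k m : ℕ) :
    chainLength x (k + m) = chainLength x k + chainLength (fun i => x (k + i)) m := by
  simp only [chainLength, Finset.sum_range_add, add_assoc]

lemma chainLength_mono (x : ℕ → E) : Monotone (chainLength x) :=
  monotone_nat_of_le_succ fun n => by
    rw [chainLength_succ]; linarith [dist_nonneg (x := x n) (y := x (n + 1))]

lemma chainLength_nonneg (x : ℕ → E) (m : ℕ) : 0 ≤ chainLength x m :=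
  Finset.sum_nonneg fun _ _ => dist_nonneg

lemma dist_le_chainLength_sub (x : ℕ → E) {a b : ℕ} (hab : a ≤ b) :
    dist (x a) (x b) ≤ chainLength x b - chainLength x a := by
  induction b, hab using Nat.le_induction with
  | base => simp
  | succ b _ ih =>
    rw [chainLength_succ]
    linarith [dist_triangle (x a) (x b) (x (b + 1))]

lemma IsChainIn.of_le {U : Set E} {δ : ℝ} {x : ℕ → E} {m k : ℕ} (h : IsChainIn U δ x m)
    (hk : k ≤ m) : IsChainIn U δ x k :=
  ⟨fun i hi => h.mem i (hi.trans hk), fun i hi => h.step i (hi.trans_le hk)⟩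

lemma IsChainIn.drop {U : Set E} {δ : ℝ} {x : ℕ → E} {m k : ℕ} (h : IsChainIn U δ x (k + m)) :
    IsChainIn U δ (fun i => x (k + i)) m :=
  ⟨fun i hi => h.mem _ (by omega), fun i hi => h.step (k + i) (by omega)⟩

lemma IsChainIn.mono {U V : Set E} {δ δ' : ℝ} {x : ℕ → E} {m : ℕ} (h : IsChainIn U δ x m)
    (hUV : U ⊆ V) (hδ : δ ≤ δ') : IsChainIn V δ' x m :=
  ⟨fun i hi => hUV (h.mem i hi), fun i hi => (h.step i hi).trans hδ⟩

/-- Almost arc-length parametrisation of a chain. -/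
lemma exists_chain_parametrization {U : Set E} {δ T : ℝ} (hδ : 0 ≤ δ) {x : ℕ → E} {m : ℕ}
    (h : IsChainIn U δ x m) (hT : 0 < T) (hlen : chainLength x m ≤ T) :
    ∃ j : ℝ → ℕ, (∀ t, j t ≤ m) ∧ Monotone j ∧ j 0 = 0 ∧ j T = m ∧
      ∀ s t, 0 ≤ s → s ≤ t → chainLength x (j t) - chainLength x (j s) ≤ t - s + δ := by
  classical
  -- The last index reached with length at most `t`.
  let k : ℝ → ℕ := fun t => Nat.findGreatest (fun n => chainLength x n ≤ t) m
  have hkm : ∀ t, k t ≤ m := fun t => Nat.findGreatest_le m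
  have hk : ∀ t, 0 ≤ t → chainLength x (k t) ≤ t := fun t ht =>
    Nat.findGreatest_spec (P := fun n => chainLength x n ≤ t) (Nat.zero_le m)
      (by simpa [chainLength_zero] using ht)
  have hkmono : Monotone k := fun s t hst =>
    Nat.findGreatest_mono (fun n (hn : chainLength x n ≤ s) => hn.trans hst) le_rfl
  -- The value `0` is imposed for `t ≤ 0`, because `k 0` is positive when the chain starts with
  -- repeated points.
  refine ⟨fun t => if t ≤ 0 then 0 else k t, ?_, ?_, by simp, ?_, ?_⟩
  · intro t
    dsimp only
    split_ifs
    exacts [Nat.zero_le _, hkm t]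
  · intro s t hst
    dsimp only
    split_ifs with h1 h2 h2
    · exact le_rfl
    · exact Nat.zero_le _
    · exact absurd (hst.trans h2) h1
    · exact hkmono hst
  · simp only [not_le.2 hT, if_false]
    exact le_antisymm (hkm T) (Nat.le_findGreatest le_rfl hlen)
  · intro s t hs hst
    dsimp only
    split_ifs with h1 h2 h2
    · simp only [sub_self]; linarith
    · exact absurd (hst.trans h1) h2
    · have := hk t (hs.trans hst)
      rw [chainLength_zero]
      have : s = 0 := le_antisymm h2 hs
      linarith
    · rcases (hkm s).eq_or_lt with h3 | h3
      · have : k t = k s := le_antisymm (h3 ▸ hkm t) (hkmono hst)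
        rw [this, sub_self]; linarith
      -- Before the end of the chain the next point overshoots `s`, so `chainLength x (k s)` exceeds
      -- `s - δ`.
      · have h4 : s < chainLength x (k s + 1) :=
          not_le.1 (Nat.findGreatest_is_greatest (P := fun n => chainLength x n ≤ s)
            (Nat.lt_succ_self _) h3)
        rw [chainLength_succ] at h4
        linarith [h.step _ h3, hk t (hs.trans hst)]

variable [NormedSpace ℝ E]

/-- The Riemann sum of the one-form `A` along the chain `x 0, …, x m`. -/
def chainSum (A : E → E →L[ℝ] ℝ) (x : ℕ → E) (m : ℕ) : ℝ :=
  ∑ i ∈ Finset.range m, A (x i) (x (i + 1) - x i)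

lemma chainSum_zero (A : E → E →L[ℝ] ℝ) (x : ℕ → E) : chainSum A x 0 = 0 := by simp [chainSum]

lemma chainSum_succ (A : E → E →L[ℝ] ℝ) (x : ℕ → E) (m : ℕ) :
    chainSum A x (m + 1) = chainSum A x m + A (x m) (x (m + 1) - x m) :=
  Finset.sum_range_succ _ _

lemma chainSum_add (A : E → E →L[ℝ] ℝ) (x : ℕ → E) (k m : ℕ) :
    chainSum A x (k + m) = chainSum A x k + chainSum A (fun i => x (k + i)) m := by
  simp only [chainSum, Finset.sum_range_add, add_assoc]

/-- Over a short stretch, the Riemann sum is close to its linearisation at the start. -/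
lemma abs_chainSum_sub_sub_le {A : E → E →L[ℝ] ℝ} {U : Set E} {e ρ : ℝ}
    (hA : ∀ p ∈ U, ∀ q ∈ U, dist p q ≤ ρ → ‖A p - A q‖ ≤ e) {x : ℕ → E} {a b : ℕ} (hab : a ≤ b)
    (hx : ∀ i ≤ b, x i ∈ U) (hlen : chainLength x b - chainLength x a ≤ ρ) :
    |chainSum A x b - chainSum A x a - A (x a) (x b - x a)|
      ≤ e * (chainLength x b - chainLength x a) := by
  induction b, hab using Nat.le_induction with
  | base => simp
  | succ b hab ih =>
    have hl := chainLength_mono x b.le_succ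
    have h1 := ih (fun i hi => hx i (hi.trans b.le_succ)) (by linarith)
    have h2 : |(A (x b) - A (x a)) (x (b + 1) - x b)| ≤ e * dist (x b) (x (b + 1)) := by
      rw [dist_eq_norm', ← Real.norm_eq_abs]
      refine (ContinuousLinearMap.le_opNorm _ _).trans ?_
      refine mul_le_mul_of_nonneg_right ?_ (norm_nonneg _)
      refine hA _ (hx b b.le_succ) _ (hx a (hab.trans b.le_succ)) ?_
      rw [dist_comm]
      linarith [dist_le_chainLength_sub x hab]
    have h3 : chainSum A x (b + 1) - chainSum A x a - A (x a) (x (b + 1) - x a)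
        = (chainSum A x b - chainSum A x a - A (x a) (x b - x a))
          + (A (x b) - A (x a)) (x (b + 1) - x b) := by
      rw [chainSum_succ]
      simp only [map_sub, sub_apply]
      ring
    rw [h3, chainLength_succ]
    refine (abs_add_le _ _).trans ?_
    linarith

/-- **Fundamental theorem of calculus along short fine chains**: the increment of `φ` along a fine
chain close to `K` of length at most `2` is close to the Riemann sum of its derivative. -/
lemma exists_abs_sub_chainSum_le {K : Set E} (hK : IsCompact K) [ProperSpace E] {φ : E → ℝ}
    {A : E → E →L[ℝ] ℝ} (hφ : Continuous φ) (hA : Continuous A)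
    (hd : ∀ x ∈ K, HasFDerivWithinAt φ (A x) K x) {η : ℝ} (hη : 0 < η) :
    ∃ δ > 0, ∀ (x : ℕ → E) (m : ℕ), IsChainIn (thickening δ K) δ x m → chainLength x m ≤ 2 →
      |φ (x m) - φ (x 0) - chainSum A x m| ≤ η := by
  by_contra! hcon
  have hpos : ∀ n : ℕ, (0 : ℝ) < 1 / ((n : ℝ) + 1) := fun n => Nat.one_div_pos_of_nat
  choose x m hx hlen hbig using fun n : ℕ => hcon (1 / ((n : ℝ) + 1)) (hpos n)
  choose j hjm hjmono hj0 hj2 hj using fun n : ℕ =>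
    exists_chain_parametrization (hpos n).le (hx n) two_pos (hlen n)
  have hδlim : Tendsto (fun n : ℕ => 1 / ((n : ℝ) + 1)) atTop (𝓝 0) :=
    tendsto_one_div_add_atTop_nhds_zero_nat
  -- An ultrafilter provides limits at all times `t` at once, without extracting subsequences.
  let 𝒰 : Ultrafilter ℕ := hyperfilter ℕ
  have h𝒰 : (𝒰 : Filter ℕ) ≤ atTop := Nat.hyperfilter_le_atTop
  have hδ𝒰 : Tendsto (fun n : ℕ => 1 / ((n : ℝ) + 1)) 𝒰 (𝓝 0) := hδlim.mono_left h𝒰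
  have hδ1 : ∀ n : ℕ, 1 / ((n : ℝ) + 1) ≤ 1 := fun n => by
    rw [div_le_one (by positivity)]; linarith [(Nat.cast_nonneg n : (0 : ℝ) ≤ n)]
  let U : Set E := cthickening 1 K
  have hU : IsCompact U := hK.cthickening
  have hxU : ∀ n, ∀ i ≤ m n, x n i ∈ U := fun n i hi =>
    thickening_subset_cthickening_of_le (hδ1 n) K ((hx n).mem i hi)
  have huc : ∀ e > 0, ∃ ρ > 0, ∀ p ∈ U, ∀ q ∈ U, dist p q ≤ ρ → ‖A p - A q‖ ≤ e := by
    intro e he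
    obtain ⟨ρ, hρ, h⟩ := Metric.uniformContinuousOn_iff_le.1
      (hU.uniformContinuousOn_of_continuous hA.continuousOn) e he
    exact ⟨ρ, hρ, fun p hp q hq hpq => by simpa [dist_eq_norm] using h p hp q hq hpq⟩
  obtain ⟨C, hC⟩ := hU.exists_bound_of_continuousOn hA.continuousOn
  -- limit curve
  have hγ : ∀ t : ℝ, ∃ p ∈ K, Tendsto (fun n => x n (j n t)) 𝒰 (𝓝 p) := by
    intro t
    have : ∀ n, ∃ q ∈ K, dist (x n (j n t)) q < 1 / ((n : ℝ) + 1) := fun n =>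
      mem_thickening_iff.1 ((hx n).mem _ (hjm n t))
    choose q hqK hq using this
    obtain ⟨p, hp, hle⟩ := hK.ultrafilter_le_nhds (𝒰.map q)
      (le_principal_iff.2 (Filter.mem_map.2 (univ_mem' hqK)))
    refine ⟨p, hp, ?_⟩
    have hqp : Tendsto q 𝒰 (𝓝 p) := hle
    refine (tendsto_iff_of_dist ?_).1 hqp
    exact squeeze_zero (fun _ => dist_nonneg) (fun n => (dist_comm _ _).trans_le (hq n).le) hδ𝒰
  choose γ hγK hγ using hγ
  -- limit of the Riemann sums
  have hS : ∀ t : ℝ, ∃ v : ℝ, Tendsto (fun n => chainSum A (x n) (j n t)) 𝒰 (𝓝 v) := by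
    intro t
    have hb : ∀ n, chainSum A (x n) (j n t) ∈ closedBall (0 : ℝ) (C * 2) := by
      intro n
      rw [mem_closedBall_zero_iff]
      have hC0 : 0 ≤ C := (norm_nonneg _).trans (hC _ (hxU n 0 (Nat.zero_le _)))
      calc ‖chainSum A (x n) (j n t)‖
          ≤ ∑ i ∈ Finset.range (j n t), C * dist (x n i) (x n (i + 1)) := by
            refine norm_sum_le_of_le _ fun i hi => ?_
            have hi' : i ≤ m n := (Finset.mem_range.1 hi).le.trans (hjm n t)
            refine (ContinuousLinearMap.le_opNorm _ _).trans ?_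
            rw [dist_eq_norm']
            exact mul_le_mul_of_nonneg_right (hC _ (hxU n i hi')) (norm_nonneg _)
        _ = C * chainLength (x n) (j n t) := by rw [← Finset.mul_sum]; rfl
        _ ≤ C * 2 := mul_le_mul_of_nonneg_left
            ((chainLength_mono _ (hjm n t)).trans (hlen n)) hC0
    obtain ⟨v, -, hle⟩ := (isCompact_closedBall (0 : ℝ) (C * 2)).ultrafilter_le_nhds
      (𝒰.map fun n => chainSum A (x n) (j n t))
      (le_principal_iff.2 (Filter.mem_map.2 (univ_mem' hb)))
    exact ⟨v, hle⟩
  choose S hS using hS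
  have hγlip : ∀ s t, 0 ≤ s → s ≤ t → dist (γ s) (γ t) ≤ t - s := by
    intro s t hs hst
    have h1 : Tendsto (fun n : ℕ => t - s + 1 / ((n : ℝ) + 1)) 𝒰 (𝓝 (t - s + 0)) :=
      tendsto_const_nhds.add hδ𝒰
    rw [add_zero] at h1
    exact le_of_tendsto_of_tendsto' ((hγ s).dist (hγ t)) h1 fun n =>
      (dist_le_chainLength_sub _ (hjmono n hst)).trans (hj n s t hs hst)
  -- The limit curve `γ` may lack derivatives, so `S` is compared with the increment of `γ` rather
  -- than with an integral of `A` against its velocity.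
  have hSlin : ∀ e > 0, ∃ τ > 0, ∀ s t, 0 ≤ s → s ≤ t → t ≤ s + τ →
      |S t - S s - A (γ s) (γ t - γ s)| ≤ e * (t - s) := by
    intro e he
    obtain ⟨ρ, hρ, hAρ⟩ := huc e he
    refine ⟨ρ / 2, half_pos hρ, fun s t hs hst hts => ?_⟩
    have h1 : Tendsto (fun n : ℕ => e * (t - s + 1 / ((n : ℝ) + 1))) 𝒰 (𝓝 (e * (t - s + 0))) :=
      (tendsto_const_nhds.add hδ𝒰).const_mul e
    rw [add_zero] at h1
    have h2 : Tendsto (fun n => |chainSum A (x n) (j n t) - chainSum A (x n) (j n s)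
        - A (x n (j n s)) (x n (j n t) - x n (j n s))|) 𝒰
        (𝓝 |S t - S s - A (γ s) (γ t - γ s)|) := by
      refine Tendsto.abs (((hS t).sub (hS s)).sub ?_)
      have hA' : Tendsto (fun n => A (x n (j n s))) 𝒰 (𝓝 (A (γ s))) := (hA.tendsto _).comp (hγ s)
      exact (isBoundedBilinearMap_apply.continuous.tendsto (A (γ s), γ t - γ s)).comp
        (hA'.prodMk_nhds ((hγ t).sub (hγ s)))
    refine le_of_tendsto_of_tendsto h2 h1 ?_
    filter_upwards [hδ𝒰.eventually (gt_mem_nhds (half_pos hρ))] with n hn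
    have h3 := hj n s t hs hst
    refine (abs_chainSum_sub_sub_le hAρ (hjmono n hst)
      (fun i hi => hxU n i (hi.trans (hjm n t))) (by linarith)).trans ?_
    exact mul_le_mul_of_nonneg_left h3 he.le
  -- The increments of `φ ∘ γ` and of `S` have the same main term `A (γ s) (γ t - γ s)`, so their
  -- difference has right derivative zero.
  have key : ∀ s, 0 ≤ s → ∀ e > 0, ∃ τ > 0, ∀ t, s ≤ t → t ≤ s + τ →
      |(φ (γ t) - S t) - (φ (γ s) - S s)| ≤ e * (t - s) := by
    intro s hs e he
    obtain ⟨τ₁, hτ₁, h1⟩ := hSlin (e / 2) (half_pos he)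
    have h2 := (hd (γ s) (hγK s)).isLittleO.def (half_pos he)
    obtain ⟨τ₂, hτ₂, h2⟩ := Metric.eventually_nhds_iff.1 (eventually_nhdsWithin_iff.1 h2)
    refine ⟨min τ₁ (τ₂ / 2), lt_min hτ₁ (half_pos hτ₂), fun t hst hts => ?_⟩
    have hl := hγlip s t hs hst
    have h3 := h1 s t hs hst (hts.trans (by gcongr; exact min_le_left _ _))
    have h5 : t ≤ s + τ₂ / 2 := hts.trans (by gcongr; exact min_le_right _ _)
    have h4 := h2 (y := γ t) (by rw [dist_comm]; linarith) (hγK t)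
    rw [← dist_eq_norm' (γ s), Real.norm_eq_abs] at h4
    have h6 : |φ (γ t) - φ (γ s) - A (γ s) (γ t - γ s)| ≤ e / 2 * (t - s) :=
      h4.trans (by gcongr)
    rw [abs_le] at h3 h6 ⊢
    constructor <;> linarith
  have hcont : ContinuousOn (fun t => φ (γ t) - S t) (Set.Icc 0 2) := by
    have hγc : ∀ s t, 0 ≤ s → 0 ≤ t → dist (γ s) (γ t) ≤ dist s t := by
      intro s t hs ht
      rcases le_total s t with h | h
      · rw [Real.dist_eq, abs_sub_comm, abs_of_nonneg (sub_nonneg.2 h)]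
        exact hγlip s t hs h
      · rw [Real.dist_eq, abs_of_nonneg (sub_nonneg.2 h), dist_comm]
        exact hγlip t s ht h
    obtain ⟨τ, hτ, hSτ⟩ := hSlin 1 one_pos
    have hCγ : ∀ t, ‖A (γ t)‖ ≤ C := fun t => hC _ (self_subset_cthickening K (hγK t))
    have hC0 : 0 ≤ C := (norm_nonneg _).trans (hCγ 0)
    have hSl : ∀ s t, 0 ≤ s → s ≤ t → t ≤ s + τ → |S t - S s| ≤ (1 + C) * (t - s) := by
      intro s t hs hst hts
      have h1 := hSτ s t hs hst hts
      have h2 : |A (γ s) (γ t - γ s)| ≤ C * (t - s) := by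
        rw [← Real.norm_eq_abs]
        refine (ContinuousLinearMap.le_opNorm _ _).trans ?_
        rw [← dist_eq_norm']
        exact mul_le_mul (hCγ s) (hγlip s t hs hst) dist_nonneg hC0
      rw [abs_le] at h1 h2 ⊢
      constructor <;> linarith
    refine ContinuousOn.sub (hφ.comp_continuousOn ?_) ?_
    · refine LipschitzOnWith.continuousOn (K := 1) (LipschitzOnWith.of_dist_le_mul ?_)
      intro s hs t ht
      simpa using hγc s t hs.1 ht.1
    · rw [Metric.continuousOn_iff]
      intro s hs e he
      refine ⟨min τ (e / (1 + C)), lt_min hτ (by positivity), fun t ht hts => ?_⟩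
      have h1 : dist t s < τ := hts.trans_le (min_le_left _ _)
      have h2 : (1 + C) * dist t s < e := by
        have := hts.trans_le (min_le_right _ _)
        rwa [lt_div_iff₀' (by positivity)] at this
      refine lt_of_le_of_lt ?_ h2
      rw [Real.dist_eq] at h1 ⊢
      rw [Real.dist_eq]
      rcases le_total s t with h | h
      · rw [abs_of_nonneg (sub_nonneg.2 h)] at h1 ⊢
        exact hSl s t hs.1 h (by linarith)
      · rw [abs_sub_comm] at h1 ⊢
        rw [abs_sub_comm t s]
        rw [abs_of_nonneg (sub_nonneg.2 h)] at h1 ⊢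
        exact hSl t s ht.1 h (by linarith)
  have hconst := constant_of_has_deriv_right_zero hcont (fun s hs => by
    rw [hasDerivWithinAt_iff_isLittleO, Asymptotics.isLittleO_iff]
    intro e he
    obtain ⟨τ, hτ, h⟩ := key s hs.1 e he
    rw [eventually_nhdsWithin_iff]
    filter_upwards [Metric.ball_mem_nhds s hτ] with t ht hst
    rw [Metric.mem_ball, Real.dist_eq, abs_of_nonneg (sub_nonneg.2 hst)] at ht
    have := h t hst (by linarith)
    rw [smul_zero, sub_zero, Real.norm_eq_abs, Real.norm_eq_abs, abs_of_nonneg (a := t - s)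
      (sub_nonneg.2 hst)]
    exact this) 2 ⟨zero_le_two, le_rfl⟩
  have hlim : Tendsto (fun n => |φ (x n (m n)) - φ (x n 0) - chainSum A (x n) (m n)|) 𝒰
      (𝓝 |φ (γ 2) - φ (γ 0) - (S 2 - S 0)|) := by
    refine Tendsto.abs (Tendsto.sub (Tendsto.sub ?_ ?_) ?_)
    · simpa only [Function.comp_def, hj2] using (hφ.tendsto _).comp (hγ 2)
    · simpa only [Function.comp_def, hj0] using (hφ.tendsto _).comp (hγ 0)
    · have := (hS 2).sub (hS 0)
      simpa only [hj2, hj0, chainSum_zero, sub_zero] using this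
  have h0 : φ (γ 2) - φ (γ 0) - (S 2 - S 0) = 0 := by
    linarith
  rw [h0, abs_zero] at hlim
  have := ge_of_tendsto' hlim fun n => (hbig n).le
  linarith

/-- The increment of `φ` along an arbitrarily long fine chain close to `K`. -/
lemma exists_sub_chainSum_le {K : Set E} (hK : IsCompact K) [ProperSpace E] {φ : E → ℝ}
    {A : E → E →L[ℝ] ℝ} (hφ : Continuous φ) (hA : Continuous A)
    (hd : ∀ x ∈ K, HasFDerivWithinAt φ (A x) K x) {η : ℝ} (hη : 0 < η) :
    ∃ δ > 0, ∀ (x : ℕ → E) (m : ℕ), IsChainIn (thickening δ K) δ x m →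
      φ (x m) - φ (x 0) - chainSum A x m ≤ η + η * chainLength x m := by
  obtain ⟨δ, hδ, h⟩ := exists_abs_sub_chainSum_le hK hφ hA hd hη
  -- Steps of size at most `1` ensure that the first initial piece of length at least `1` has length
  -- at most `2`.
  refine ⟨min δ 1, lt_min hδ one_pos, fun x m hx => ?_⟩
  have hsub : thickening (min δ 1) K ⊆ thickening δ K := thickening_mono (min_le_left _ _) K
  induction m using Nat.strong_induction_on generalizing x with
  | _ m ih =>
    by_cases hlen : chainLength x m ≤ 2
    · have h1 := (abs_le.1 (h x m (hx.mono hsub (min_le_left _ _)) hlen)).2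
      have h2 := mul_nonneg hη.le (chainLength_nonneg x m)
      linarith
    -- Each piece cut off has length at least `1`, so its error `η` is paid for by `η` times its
    -- length; the last piece costs the additive `η`.
    · classical
      have hex : ∃ k, 1 ≤ chainLength x k := ⟨m, by linarith⟩
      obtain ⟨k, hk1, hkmin⟩ : ∃ k, 1 ≤ chainLength x k ∧ ∀ l < k, chainLength x l < 1 :=
        ⟨Nat.find hex, Nat.find_spec hex, fun l hl => not_le.1 (Nat.find_min hex hl)⟩
      have hk0 : k ≠ 0 := by
        rintro rfl
        rw [chainLength_zero] at hk1
        linarith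
      obtain ⟨l, rfl⟩ := Nat.exists_eq_succ_of_ne_zero hk0
      have hkm : l + 1 ≤ m := by
        by_contra! hlt
        linarith [hkmin m hlt]
      obtain ⟨n, rfl⟩ := Nat.exists_eq_add_of_le hkm
      have hk2 : chainLength x (l + 1) ≤ 2 := by
        rw [chainLength_succ]
        linarith [hkmin l l.lt_succ_self, hx.step l (by omega), min_le_right δ 1]
      have h1 := (abs_le.1 (h x (l + 1) ((hx.of_le hkm).mono hsub (min_le_left _ _)) hk2)).2
      have h2 := ih n (by omega) (fun i => x (l + 1 + i)) hx.drop
      rw [chainSum_add, chainLength_add]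
      simp only [add_zero] at h2
      nlinarith

/-- The values `φ (x 0) + ∑ (A (x i) (x (i + 1) - x i) + ε |x (i + 1) - x i|)` for the chains
`x 0, …, x m` in `U` ending at `y`. -/
def chainCosts (φ : E → ℝ) (A : E → E →L[ℝ] ℝ) (U : Set E) (δ ε : ℝ) (y : E) : Set ℝ :=
  {c | ∃ (x : ℕ → E) (m : ℕ), IsChainIn U δ x m ∧ x m = y ∧
    c = φ (x 0) + chainSum A x m + ε * chainLength x m}

lemma mem_chainCosts_self {φ : E → ℝ} {A : E → E →L[ℝ] ℝ} {U : Set E} {δ ε : ℝ} {y : E}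
    (hy : y ∈ U) : φ y ∈ chainCosts φ A U δ ε y :=
  ⟨fun _ => y, 0, ⟨fun _ _ => hy, fun _ h => absurd h (Nat.not_lt_zero _)⟩, rfl, by
    simp [chainSum_zero, chainLength_zero]⟩

/-- Extending a chain by one point is what bounds the increments of the infimum of the costs from
above. -/
lemma mem_chainCosts_step {φ : E → ℝ} {A : E → E →L[ℝ] ℝ} {U : Set E} {δ ε c : ℝ} {y z : E}
    (hc : c ∈ chainCosts φ A U δ ε y) (hz : z ∈ U) (hyz : dist y z ≤ δ) :
    c + A y (z - y) + ε * dist y z ∈ chainCosts φ A U δ ε z := by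
  obtain ⟨x, m, hx, rfl, rfl⟩ := hc
  let x' : ℕ → E := fun i => if i ≤ m then x i else z
  have hle : ∀ i ≤ m, x' i = x i := fun i hi => if_pos hi
  have hlast : x' (m + 1) = z := if_neg (by omega)
  have hL : chainLength x' m = chainLength x m := Finset.sum_congr rfl fun i hi => by
    have := Finset.mem_range.1 hi
    rw [hle i this.le, hle (i + 1) this]
  have hS : chainSum A x' m = chainSum A x m := Finset.sum_congr rfl fun i hi => by
    have := Finset.mem_range.1 hi
    rw [hle i this.le, hle (i + 1) this]
  refine ⟨x', m + 1, ⟨fun i hi => ?_, fun i hi => ?_⟩, hlast, ?_⟩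
  · rcases hi.eq_or_lt with rfl | hi
    · rwa [hlast]
    · rw [hle i (by omega)]
      exact hx.mem i (by omega)
  · rcases (Nat.lt_succ_iff.1 hi).eq_or_lt with rfl | hi
    · rwa [hlast, hle i le_rfl]
    · rw [hle i hi.le, hle (i + 1) hi]
      exact hx.step i hi
  · rw [chainSum_succ, chainLength_succ, hL, hS, hlast, hle m le_rfl, hle 0 (Nat.zero_le _)]
    ring

/-- A function differentiable along a compact set `K` with continuous derivative is close, on a
neighbourhood of `K`, to a function whose increments at small scales are controlled uniformly by
the derivative. -/
theorem exists_locally_almost_linear_near {K : Set E} (hK : IsCompact K) [ProperSpace E]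
    {φ : E → ℝ} {A : E → E →L[ℝ] ℝ} (hφ : Continuous φ) (hA : Continuous A)
    (hd : ∀ x ∈ K, HasFDerivWithinAt φ (A x) K x) {ε : ℝ} (hε : 0 < ε) :
    ∃ δ > 0, ∃ g : E → ℝ, δ ≤ 1 ∧ (∀ x ∈ thickening δ K, |g x - φ x| ≤ ε) ∧
      (∀ x ∈ thickening δ K, ∀ y ∈ thickening δ K, dist x y ≤ δ → ‖A y - A x‖ ≤ ε) ∧
      ∀ x ∈ thickening δ K, ∀ y ∈ thickening δ K, dist x y ≤ δ →
        |g y - g x - A x (y - x)| ≤ 2 * ε * dist x y := by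
  obtain ⟨δ₁, hδ₁, hchain⟩ := exists_sub_chainSum_le hK hφ hA hd hε
  obtain ⟨δ₂, hδ₂, hunif⟩ := Metric.uniformContinuousOn_iff_le.1
    ((hK.cthickening (r := 1)).uniformContinuousOn_of_continuous hA.continuousOn) ε hε
  obtain ⟨δ, hδ, hle₁, hle₂, hle⟩ : ∃ δ > 0, δ ≤ δ₁ ∧ δ ≤ δ₂ ∧ δ ≤ 1 :=
    ⟨min δ₁ (min δ₂ 1), lt_min hδ₁ (lt_min hδ₂ one_pos), min_le_left _ _,
      (min_le_right _ _).trans (min_le_left _ _), (min_le_right _ _).trans (min_le_right _ _)⟩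
  let U := thickening δ K
  let C : E → Set ℝ := chainCosts φ A U δ ε
  -- The penalty `ε * chainLength` absorbs the part of the error proportional to the length.
  have hlow : ∀ y, ∀ c ∈ C y, φ y - ε ≤ c := by
    rintro y c ⟨x, m, hx, rfl, rfl⟩
    have := hchain x m (hx.mono (thickening_mono hle₁ K) hle₁)
    linarith
  have hbdd : ∀ y, BddBelow (C y) := fun y => ⟨_, hlow y⟩
  have hAU : ∀ x ∈ U, ∀ y ∈ U, dist x y ≤ δ → ‖A y - A x‖ ≤ ε := by
    intro x hx y hy hxy
    rw [← dist_eq_norm, dist_comm]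
    exact hunif x (thickening_subset_cthickening_of_le hle K hx) y
      (thickening_subset_cthickening_of_le hle K hy) (hxy.trans hle₂)
  have hstep : ∀ x ∈ U, ∀ y ∈ U, dist x y ≤ δ →
      sInf (C y) ≤ sInf (C x) + A x (y - x) + ε * dist x y := by
    intro x hx y hy hxy
    have : sInf (C y) - A x (y - x) - ε * dist x y ≤ sInf (C x) :=
      le_csInf ⟨_, mem_chainCosts_self hx⟩ fun c hc => by
        have := csInf_le (hbdd y) (mem_chainCosts_step hc hy hxy)
        linarith
    linarith
  refine ⟨δ, hδ, fun y => sInf (C y), hle, fun x hx => ?_, hAU, fun x hx y hy hxy => ?_⟩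
  · have h1 : sInf (C x) ≤ φ x := csInf_le (hbdd x) (mem_chainCosts_self hx)
    have h2 : φ x - ε ≤ sInf (C x) := le_csInf ⟨_, mem_chainCosts_self hx⟩ (hlow x)
    rw [abs_le]
    constructor <;> linarith
  · have h1 := hstep x hx y hy hxy
    -- The reversed step involves `A y`; passing to `A x` costs a second `ε * dist x y`.
    have h2 := hstep y hy x hx (by rwa [dist_comm])
    have h3 : |(A y - A x) (y - x)| ≤ ε * dist x y := by
      rw [dist_eq_norm', ← Real.norm_eq_abs]
      exact (ContinuousLinearMap.le_opNorm _ _).trans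
        (mul_le_mul_of_nonneg_right (hAU x hx y hy hxy) (norm_nonneg _))
    rw [← neg_sub y x, map_neg, dist_comm y x] at h2
    rw [sub_apply] at h3
    have h4 := abs_le.1 h3
    rw [abs_le]
    constructor <;> linarith

end Chains

/-! ### Functions computed by shallow networks -/

section Networks

open scoped InnerProductSpace

variable {d : ℕ} {F : Type*} [NormedAddCommGroup F] [NormedSpace ℝ F]

/-- The vector space of the functions computed by networks with activation `σ`. -/
def netSpace (d : ℕ) (F : Type*) [NormedAddCommGroup F] [NormedSpace ℝ F] (σ : ℝ → ℝ) :
    Submodule ℝ (EuclideanSpace ℝ (Fin d) → F) where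
  carrier := Set.range fun N : ShallowNet d F => N.eval σ
  zero_mem' := ⟨⟨0, Fin.elim0, Fin.elim0, Fin.elim0, 0⟩, by
    funext x
    simp [ShallowNet.eval]⟩
  add_mem' := by
    rintro _ _ ⟨N, rfl⟩ ⟨M, rfl⟩
    refine ⟨⟨N.width + M.width, Fin.append N.weight M.weight, Fin.append N.bias M.bias,
      Fin.append N.out M.out, N.outBias + M.outBias⟩, ?_⟩
    funext x
    simp only [ShallowNet.eval, Fin.sum_univ_add, Fin.append_left, Fin.append_right, Pi.add_apply]
    abel
  smul_mem' := by
    rintro c _ ⟨N, rfl⟩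
    refine ⟨⟨N.width, N.weight, N.bias, fun i => c • N.out i, c • N.outBias⟩, ?_⟩
    funext x
    simp only [ShallowNet.eval, Pi.smul_apply, smul_add, Finset.smul_sum, smul_comm c]

lemma const_mem_netSpace (σ : ℝ → ℝ) (c : F) : (fun _ => c) ∈ netSpace d F σ :=
  ⟨⟨0, Fin.elim0, Fin.elim0, Fin.elim0, c⟩, by
    funext x
    simp [ShallowNet.eval]⟩

lemma neuron_mem_netSpace (σ : ℝ → ℝ) (w : EuclideanSpace ℝ (Fin d)) (b : ℝ) (a : F) :
    (fun x => σ (⟪w, x⟫_ℝ + b) • a) ∈ netSpace d F σ :=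
  ⟨⟨1, fun _ => w, fun _ => b, fun _ => a, 0⟩, by
    funext x
    simp [ShallowNet.eval]⟩

lemma smul_const_mem_netSpace {σ : ℝ → ℝ} {h : EuclideanSpace ℝ (Fin d) → ℝ}
    (hh : h ∈ netSpace d ℝ σ) (v : F) : (fun x => h x • v) ∈ netSpace d F σ := by
  obtain ⟨N, rfl⟩ := hh
  refine ⟨⟨N.width, N.weight, N.bias, fun i => N.out i • v, N.outBias • v⟩, ?_⟩
  funext x
  simp only [ShallowNet.eval, add_smul, Finset.sum_smul, smul_eq_mul, mul_smul]

/-- Two leaky units combine to a ReLU, as `1 - α ^ 2 ≠ 0`; this reduces the leaky case to `relu`. -/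
lemma leakyRelu_add_mul_leakyRelu_neg (α t : ℝ) :
    leakyRelu α t + α * leakyRelu α (-t) = (1 - α ^ 2) * relu t := by
  rcases lt_trichotomy t 0 with h | rfl | h
  · rw [leakyRelu, leakyRelu, relu, if_neg (not_le.2 h), if_pos (by linarith), max_eq_right h.le]
    ring
  · simp [leakyRelu, relu]
  · rw [leakyRelu, leakyRelu, relu, if_pos h.le, if_neg (by linarith), max_eq_left h.le]
    ring

lemma relu_neuron_mem_netSpace {σ : ℝ → ℝ} (hσ : IsReluOrLeakyRelu σ)
    (w : EuclideanSpace ℝ (Fin d)) (b : ℝ) :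
    (fun x => relu (⟪w, x⟫_ℝ + b)) ∈ netSpace d ℝ σ := by
  rcases hσ with rfl | ⟨α, h0, h1, rfl⟩
  · simpa using neuron_mem_netSpace relu w b (1 : ℝ)
  · have hne : 1 - α ^ 2 ≠ 0 := by nlinarith
    have h2 := (netSpace d ℝ (leakyRelu α)).smul_mem (1 - α ^ 2)⁻¹
      ((netSpace d ℝ (leakyRelu α)).add_mem
        (neuron_mem_netSpace (leakyRelu α) w b (1 : ℝ))
        (neuron_mem_netSpace (leakyRelu α) (-w) (-b) α))
    convert h2 using 1
    funext x
    have h3 := leakyRelu_add_mul_leakyRelu_neg α (⟪w, x⟫_ℝ + b)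
    have h4 : ⟪-w, x⟫_ℝ + -b = -(⟪w, x⟫_ℝ + b) := by rw [inner_neg_left]; ring
    simp only [Pi.smul_apply, Pi.add_apply, smul_eq_mul, mul_one]
    rw [h4, mul_comm (leakyRelu α (-_)) α, h3, inv_mul_cancel_left₀ hne]

lemma lipschitzWith_relu : LipschitzWith 1 relu := LipschitzWith.id.max_const 0

lemma IsReluOrLeakyRelu.exists_lipschitzWith {σ : ℝ → ℝ} (hσ : IsReluOrLeakyRelu σ) :
    ∃ C, LipschitzWith C σ := by
  rcases hσ with rfl | ⟨α, h0, h1, rfl⟩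
  · exact ⟨1, lipschitzWith_relu⟩
  · have h : leakyRelu α = fun t => max t (α * t) := by
      funext t
      rw [leakyRelu]
      split_ifs with ht
      · rw [max_eq_left]
        nlinarith
      · rw [max_eq_right]
        nlinarith
    rw [h]
    exact ⟨_, LipschitzWith.id.max (lipschitzWith_smul α)⟩

/-- Needed for differentiability almost everywhere, through Rademacher's theorem. -/
lemma ShallowNet.exists_lipschitzWith {σ : ℝ → ℝ} (hσ : IsReluOrLeakyRelu σ)
    (N : ShallowNet d F) : ∃ C, LipschitzWith C (N.eval σ) := by
  obtain ⟨C, hC⟩ := hσ.exists_lipschitzWith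
  have hunit : ∀ i, LipschitzWith (‖N.out i‖₊ * (C * ‖N.weight i‖₊))
      fun x => σ (inner ℝ (N.weight i) x + N.bias i) • N.out i := by
    intro i
    refine LipschitzWith.of_dist_le_mul fun x y => ?_
    have h1 := hC.dist_le_mul (inner ℝ (N.weight i) x + N.bias i)
      (inner ℝ (N.weight i) y + N.bias i)
    have h2 : dist (inner ℝ (N.weight i) x + N.bias i) (inner ℝ (N.weight i) y + N.bias i)
        ≤ ‖N.weight i‖ * dist x y := by
      rw [dist_add_right, Real.dist_eq, ← inner_sub_right, dist_eq_norm]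
      exact abs_real_inner_le_norm _ _
    rw [dist_eq_norm, ← sub_smul, norm_smul, ← dist_eq_norm]
    push_cast
    calc _ ≤ (C * (‖N.weight i‖ * dist x y)) * ‖N.out i‖ := by
          gcongr
          exact h1.trans (by gcongr)
      _ = _ := by ring
  refine ⟨∑ i, (‖N.out i‖₊ * (C * ‖N.weight i‖₊)), LipschitzWith.of_dist_le_mul fun x y => ?_⟩
  rw [ShallowNet.eval, ShallowNet.eval, dist_add_right]
  refine (dist_sum_sum_le _ _ _).trans ?_
  push_cast
  rw [Finset.sum_mul]
  refine Finset.sum_le_sum fun i _ => ?_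
  simpa using (hunit i).dist_le_mul x y

end Networks

/-! ### Piecewise linear interpolation -/

section Interpolation

lemma add_relu_sub_relu {a b : ℝ} (hab : a ≤ b) (t : ℝ) :
    a + (relu (t - a) - relu (t - b)) = max a (min t b) := by
  simp only [relu]
  rcases le_total t a with h1 | h1
  · rw [max_eq_right (by linarith), max_eq_right (by linarith), min_eq_left (h1.trans hab),
      max_eq_left h1]
    ring
  · rcases le_total t b with h2 | h2
    · rw [max_eq_left (by linarith), max_eq_right (by linarith), min_eq_left h2, max_eq_right h1]
      ring
    · rw [max_eq_left (by linarith), max_eq_left (by linarith), min_eq_right h2, max_eq_right hab]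
      ring

/-- The clamped variable sweeps the cells one after another, so the sum telescopes. -/
lemma sum_sub_clamp {τ : ℕ → ℝ} (hτ : Monotone τ) (p : ℝ → ℝ) {t : ℝ} (ht : τ 0 ≤ t) (n : ℕ) :
    ∑ i ∈ Finset.range n, (p (max (τ i) (min t (τ (i + 1)))) - p (τ i))
      = p (min t (τ n)) - p (τ 0) := by
  induction n with
  | zero => simp [min_eq_right ht]
  | succ n ih =>
    rw [Finset.sum_range_succ, ih]
    have h1 : τ n ≤ τ (n + 1) := hτ n.le_succ
    rcases le_total t (τ n) with h | h
    · rw [min_eq_left h, min_eq_left (h.trans h1), max_eq_left h]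
      ring
    · rw [min_eq_right h, max_eq_right (le_min h h1)]
      ring

/-- A `C^1` function on an interval is the sum of a piecewise linear function and a function with
small Lipschitz constant. -/
lemma exists_relu_sum_sub_lipschitz {p p' : ℝ → ℝ} (hp : ∀ t, HasDerivAt p (p' t) t)
    (hp' : Continuous p') {R ε : ℝ} (hR : 0 < R) (hε : 0 < ε) :
    ∃ (n : ℕ) (m τ : ℕ → ℝ), ∀ s ∈ Set.Icc (-R) R, ∀ t ∈ Set.Icc (-R) R,
      |(p t - ∑ i ∈ Finset.range n, m i * (relu (t - τ i) - relu (t - τ (i + 1))))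
        - (p s - ∑ i ∈ Finset.range n, m i * (relu (s - τ i) - relu (s - τ (i + 1))))|
      ≤ ε * |t - s| := by
  obtain ⟨ρ, hρ, hunif⟩ := Metric.uniformContinuousOn_iff_le.1
    ((isCompact_Icc (a := -R) (b := R)).uniformContinuousOn_of_continuous hp'.continuousOn) ε hε
  obtain ⟨n, hn⟩ := exists_nat_gt (2 * R / ρ)
  have hn0 : (0 : ℝ) < n := lt_trans (by positivity) hn
  let τ : ℕ → ℝ := fun i => -R + i * (2 * R / n)
  have hstep : ∀ i, τ (i + 1) = τ i + 2 * R / n := fun i => by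
    simp only [τ]
    push_cast
    ring
  have hh : 2 * R / n ≤ ρ := by
    rw [div_lt_iff₀ hρ] at hn
    rw [div_le_iff₀ hn0]
    linarith
  have hh0 : 0 < 2 * R / n := by positivity
  have hτ : Monotone τ := monotone_nat_of_le_succ fun i => by rw [hstep]; linarith
  have hτ0 : τ 0 = -R := by simp [τ]
  have hτn : τ n = R := by
    simp only [τ]
    field_simp
    ring
  -- The slope on each cell is the derivative at its left end, within `ε` of `p'` throughout the
  -- cell.
  refine ⟨n, fun i => p' (τ i), τ, ?_⟩
  let κ : ℕ → ℝ → ℝ := fun i t => max (τ i) (min t (τ (i + 1)))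
  have hκmem : ∀ i t, κ i t ∈ Set.Icc (τ i) (τ (i + 1)) := fun i t =>
    ⟨le_max_left _ _, max_le (hτ i.le_succ) (min_le_right _ _)⟩
  have hκmono : ∀ i, Monotone (κ i) := fun i s t hst =>
    max_le_max le_rfl (min_le_min hst le_rfl)
  have hq : ∀ i < n, ∀ x ∈ Set.Icc (τ i) (τ (i + 1)), ∀ y ∈ Set.Icc (τ i) (τ (i + 1)),
      |(p y - p' (τ i) * y) - (p x - p' (τ i) * x)| ≤ ε * |y - x| := by
    intro i hi x hx y hy
    have hsub : Set.Icc (τ i) (τ (i + 1)) ⊆ Set.Icc (-R) R :=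
      Set.Icc_subset_Icc (hτ0 ▸ hτ (Nat.zero_le i)) (hτn ▸ hτ hi)
    refine (convex_Icc (τ i) (τ (i + 1))).norm_image_sub_le_of_norm_hasDerivWithin_le
      (f := fun x => p x - p' (τ i) * x) (f' := fun x => p' x - p' (τ i)) (fun z _ => ?_)
      (fun z hz => ?_) hx hy
    · simpa using (((hp z).fun_sub ((hasDerivAt_id' z).const_mul (p' (τ i)))).hasDerivWithinAt
        (s := Set.Icc (τ i) (τ (i + 1))))
    · rw [← dist_eq_norm]
      refine hunif z (hsub hz) (τ i) (hsub ⟨le_rfl, hτ i.le_succ⟩) ?_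
      have h1 := hz.2
      rw [hstep] at h1
      rw [Real.dist_eq, abs_of_nonneg (sub_nonneg.2 hz.1)]
      linarith
  have hrelu : ∀ i t, relu (t - τ i) - relu (t - τ (i + 1)) = κ i t - τ i := fun i t => by
    simp only [κ]
    rw [← add_relu_sub_relu (hτ i.le_succ) t]
    ring
  simp only [hrelu]
  have hdecomp : ∀ t ∈ Set.Icc (-R) R, p t - ∑ i ∈ Finset.range n, p' (τ i) * (κ i t - τ i)
      = p (τ 0) + ∑ i ∈ Finset.range n,
        ((p (κ i t) - p' (τ i) * κ i t) - (p (τ i) - p' (τ i) * τ i)) := by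
    intro t ht
    have h1 := sum_sub_clamp hτ p (hτ0 ▸ ht.1) n
    rw [hτn, min_eq_left ht.2] at h1
    have h2 : p t = p (τ 0) + ∑ i ∈ Finset.range n, (p (κ i t) - p (τ i)) := by
      rw [h1]
      ring
    rw [h2, add_sub_assoc, ← Finset.sum_sub_distrib]
    congr 1
    exact Finset.sum_congr rfl fun i _ => by ring
  have hmain : ∀ s ∈ Set.Icc (-R) R, ∀ t ∈ Set.Icc (-R) R, s ≤ t →
      |(p t - ∑ i ∈ Finset.range n, p' (τ i) * (κ i t - τ i))
        - (p s - ∑ i ∈ Finset.range n, p' (τ i) * (κ i s - τ i))| ≤ ε * |t - s| := by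
    intro s hs t ht hst
    -- The clamped increments of `[s, t]` add up to `t - s`, so the error is independent of the
    -- number of cells.
    have hid : ∀ t ∈ Set.Icc (-R) R, ∑ i ∈ Finset.range n, (κ i t - τ i) = t - τ 0 := by
      intro t ht
      have h1 := sum_sub_clamp hτ id (hτ0 ▸ ht.1) n
      rwa [hτn, min_eq_left ht.2] at h1
    rw [hdecomp t ht, hdecomp s hs, add_sub_add_left_eq_sub, ← Finset.sum_sub_distrib]
    calc _ ≤ ∑ i ∈ Finset.range n, ε * ((κ i t - τ i) - (κ i s - τ i)) := by
          refine (Finset.abs_sum_le_sum_abs _ _).trans (Finset.sum_le_sum fun i hi => ?_)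
          have h1 := hq i (Finset.mem_range.1 hi) _ (hκmem i s) _ (hκmem i t)
          rw [abs_of_nonneg (sub_nonneg.2 (hκmono i hst))] at h1
          rw [sub_sub_sub_cancel_right, sub_sub_sub_cancel_right]
          exact h1
      _ = ε * |t - s| := by
          rw [← Finset.mul_sum, Finset.sum_sub_distrib, hid t ht, hid s hs,
            abs_of_nonneg (sub_nonneg.2 hst)]
          ring
  intro s hs t ht
  rcases le_total s t with h | h
  · exact hmain s hs t ht h
  · rw [abs_sub_comm, abs_sub_comm t s]
    exact hmain t ht s hs h

end Interpolation

/-! ### Sums of exponential ridge functions -/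

section Exponentials

open scoped InnerProductSpace

/-- The span of the ridge functions `x ↦ exp ⟪w, x⟫`. -/
def expSpan (E : Type*) [NormedAddCommGroup E] [InnerProductSpace ℝ E] : Submodule ℝ (E → ℝ) :=
  Submodule.span ℝ (Set.range fun w : E => fun x => Real.exp ⟪w, x⟫_ℝ)

lemma exists_netSpace_sub_exp_lipschitz {d : ℕ} {σ : ℝ → ℝ} (hσ : IsReluOrLeakyRelu σ)
    (w : EuclideanSpace ℝ (Fin d)) {R ε : ℝ} (hR : 0 < R) (hε : 0 < ε) :
    ∃ h ∈ netSpace d ℝ σ, ∀ x ∈ closedBall (0 : EuclideanSpace ℝ (Fin d)) R,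
      ∀ y ∈ closedBall (0 : EuclideanSpace ℝ (Fin d)) R,
      |(Real.exp ⟪w, y⟫_ℝ - h y) - (Real.exp ⟪w, x⟫_ℝ - h x)| ≤ ε * ‖y - x‖ := by
  have hw : 0 < ‖w‖ + 1 := by positivity
  obtain ⟨n, m, τ, hs⟩ := exists_relu_sum_sub_lipschitz Real.hasDerivAt_exp Real.continuous_exp
    (mul_pos hw hR) (div_pos hε hw)
  refine ⟨fun x => ∑ i ∈ Finset.range n,
    m i * (relu (⟪w, x⟫_ℝ - τ i) - relu (⟪w, x⟫_ℝ - τ (i + 1))), ?_, ?_⟩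
  · have : (fun x : EuclideanSpace ℝ (Fin d) => ∑ i ∈ Finset.range n,
        m i * (relu (⟪w, x⟫_ℝ - τ i) - relu (⟪w, x⟫_ℝ - τ (i + 1))))
        = ∑ i ∈ Finset.range n, m i • ((fun x => relu (⟪w, x⟫_ℝ + -τ i))
          - fun x => relu (⟪w, x⟫_ℝ + -τ (i + 1))) := by
      funext x
      simp [Finset.sum_apply, sub_eq_add_neg, mul_add]
    rw [this]
    exact Submodule.sum_mem _ fun i _ => Submodule.smul_mem _ _
      (Submodule.sub_mem _ (relu_neuron_mem_netSpace hσ w _) (relu_neuron_mem_netSpace hσ w _))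
  · have hmem : ∀ x ∈ closedBall (0 : EuclideanSpace ℝ (Fin d)) R,
        ⟪w, x⟫_ℝ ∈ Set.Icc (-((‖w‖ + 1) * R)) ((‖w‖ + 1) * R) := by
      intro x hx
      rw [mem_closedBall_zero_iff] at hx
      rw [Set.mem_Icc, ← abs_le]
      refine (abs_real_inner_le_norm _ _).trans ?_
      gcongr
      linarith
    intro x hx y hy
    refine (hs _ (hmem x hx) _ (hmem y hy)).trans ?_
    rw [← inner_sub_right, div_mul_eq_mul_div, div_le_iff₀ hw, mul_assoc]
    refine mul_le_mul_of_nonneg_left ((abs_real_inner_le_norm _ _).trans ?_) hε.le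
    rw [mul_comm]
    gcongr
    linarith

/-- Sums of exponential ridge functions are approximated by networks in the Lipschitz seminorm. -/
lemma exists_netSpace_sub_lipschitz_of_mem_expSpan {d : ℕ} {σ : ℝ → ℝ}
    (hσ : IsReluOrLeakyRelu σ) {e : EuclideanSpace ℝ (Fin d) → ℝ}
    (he : e ∈ expSpan (EuclideanSpace ℝ (Fin d))) {R : ℝ} (hR : 0 < R) :
    ∀ ε > 0, ∃ h ∈ netSpace d ℝ σ, ∀ x ∈ closedBall (0 : EuclideanSpace ℝ (Fin d)) R,
      ∀ y ∈ closedBall (0 : EuclideanSpace ℝ (Fin d)) R,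
      |(e y - h y) - (e x - h x)| ≤ ε * ‖y - x‖ := by
  induction he using Submodule.span_induction with
  | mem e he =>
    obtain ⟨w, rfl⟩ := he
    exact fun ε hε => exists_netSpace_sub_exp_lipschitz hσ w hR hε
  | zero =>
    refine fun ε hε => ⟨0, Submodule.zero_mem _, fun x _ y _ => ?_⟩
    simp only [Pi.zero_apply, sub_zero, abs_zero]
    positivity
  | add e₁ e₂ _ _ ih₁ ih₂ =>
    intro ε hε
    obtain ⟨h₁, hm₁, hl₁⟩ := ih₁ (ε / 2) (half_pos hε)
    obtain ⟨h₂, hm₂, hl₂⟩ := ih₂ (ε / 2) (half_pos hε)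
    refine ⟨h₁ + h₂, Submodule.add_mem _ hm₁ hm₂, fun x hx y hy => ?_⟩
    have h1 := abs_le.1 (hl₁ x hx y hy)
    have h2 := abs_le.1 (hl₂ x hx y hy)
    simp only [Pi.add_apply]
    rw [abs_le]
    constructor <;> linarith
  | smul c e _ ih =>
    intro ε hε
    have hc : 0 < |c| + 1 := by positivity
    obtain ⟨h, hm, hl⟩ := ih (ε / (|c| + 1)) (div_pos hε hc)
    refine ⟨c • h, Submodule.smul_mem _ _ hm, fun x hx y hy => ?_⟩
    simp only [Pi.smul_apply, smul_eq_mul]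
    rw [← mul_sub, ← mul_sub, ← mul_sub, abs_mul]
    calc |c| * _ ≤ (|c| + 1) * (ε / (|c| + 1) * ‖y - x‖) :=
          mul_le_mul (by linarith) (hl x hx y hy) (abs_nonneg _) hc.le
      _ = ε * ‖y - x‖ := by
          field_simp

/-- Sums of exponential ridge functions are dense for uniform convergence on compact sets. -/
lemma exists_mem_expSpan_near {E : Type*} [NormedAddCommGroup E] [InnerProductSpace ℝ E]
    {f : E → ℝ} (hf : Continuous f) {B : Set E} (hB : IsCompact B) {ε : ℝ} (hε : 0 < ε) :
    ∃ e ∈ expSpan E, ∀ x ∈ B, |f x - e x| ≤ ε := by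
  -- As the range of a monoid morphism, the exponentials are closed under products; the algebra they
  -- generate is their linear span.
  let M : Multiplicative E →* C(E, ℝ) :=
    { toFun := fun w => ⟨fun x => Real.exp ⟪w.toAdd, x⟫_ℝ, by fun_prop⟩
      map_one' := by
        ext x
        simp
      map_mul' := fun v w => by
        ext x
        simp [inner_add_left, Real.exp_add] }
  let S : Subalgebra ℝ C(E, ℝ) := Algebra.adjoin ℝ (MonoidHom.mrange M : Set C(E, ℝ))
  have hS : S.SeparatesPoints := by
    intro x y hxy
    refine ⟨_, ⟨M (.ofAdd (x - y)), Algebra.subset_adjoin ⟨_, rfl⟩, rfl⟩, fun h => hxy ?_⟩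
    have h1 : Real.exp ⟪x - y, x⟫_ℝ = Real.exp ⟪x - y, y⟫_ℝ := h
    have h2 := Real.exp_injective h1
    rwa [← sub_eq_zero, ← inner_sub_right, inner_self_eq_zero, sub_eq_zero] at h2
  obtain ⟨g, hg, hgf⟩ :=
    ContinuousMap.exists_mem_subalgebra_near_continuous_of_isCompact_of_separatesPoints hS ⟨f, hf⟩
      hB hε
  have hspan : Subalgebra.toSubmodule S = Submodule.span ℝ (MonoidHom.mrange M : Set C(E, ℝ)) := by
    rw [Algebra.adjoin_eq_span, Submonoid.closure_eq]
  have hg' : g ∈ Submodule.span ℝ (MonoidHom.mrange M : Set C(E, ℝ)) := hspan ▸ hg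
  refine ⟨g, ?_, fun x hx => ?_⟩
  · clear hg hgf
    induction hg' using Submodule.span_induction with
    | mem g h =>
      obtain ⟨w, rfl⟩ := h
      exact Submodule.subset_span ⟨w.toAdd, rfl⟩
    | zero => exact Submodule.zero_mem _
    | add g₁ g₂ _ _ h₁ h₂ => exact Submodule.add_mem _ h₁ h₂
    | smul c g _ h => exact Submodule.smul_mem _ c h
  · rw [abs_sub_comm]
    exact (hgf x hx).le

end Exponentials

/-! ### Averages of Lipschitz functions -/

section Averages

open scoped InnerProductSpace NNReal

/-- A bounded function on a bounded set which is Lipschitz at small scales agrees there with a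
Lipschitz function of bounded support. -/
lemma exists_lipschitzWith_eqOn {E : Type*} [NormedAddCommGroup E] {U : Set E} {g : E → ℝ}
    {δ L B R : ℝ} (hδ : 0 < δ) (hL : 0 ≤ L)
    (hU : ∀ x ∈ U, ‖x‖ ≤ R) (hB : ∀ x ∈ U, |g x| ≤ B)
    (hg : ∀ x ∈ U, ∀ y ∈ U, dist x y ≤ δ → |g y - g x| ≤ L * dist x y) :
    ∃ (G : E → ℝ) (C : ℝ≥0) (R' : ℝ), LipschitzWith C G ∧ (∀ x, R' < ‖x‖ → G x = 0) ∧
      ∀ x ∈ U, G x = g x := by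
  rcases U.eq_empty_or_nonempty with rfl | ⟨x₀, hx₀⟩
  · exact ⟨0, 0, 0, LipschitzWith.const 0, fun _ _ => rfl, fun _ h => h.elim⟩
  have hB0 : 0 ≤ B := (abs_nonneg _).trans (hB x₀ hx₀)
  have hLip : LipschitzOnWith (Real.toNNReal (L + 2 * B / δ)) g U := by
    refine LipschitzOnWith.of_dist_le_mul fun x hx y hy => ?_
    rw [Real.coe_toNNReal _ (by positivity), Real.dist_eq, abs_sub_comm]
    rcases le_total (dist x y) δ with h | h
    · refine (hg x hx y hy h).trans ?_
      gcongr
      have : 0 ≤ 2 * B / δ := by positivity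
      linarith
    · have h1 : |g y - g x| ≤ 2 * B := by
        have h2 := abs_le.1 (hB x hx)
        have h3 := abs_le.1 (hB y hy)
        rw [abs_le]
        constructor <;> linarith
      have h2 : 2 * B ≤ 2 * B / δ * dist x y := by
        rw [div_mul_eq_mul_div, le_div_iff₀ hδ]
        gcongr
      have h3 : 0 ≤ L * dist x y := by positivity
      linarith
  obtain ⟨g₁, hg₁, heq⟩ := hLip.extend_real
  -- A cone at least `B` on `U` and zero outside radius `B + R`: truncating at `±T` leaves `g`
  -- unchanged on `U` and bounds the support.
  let T : E → ℝ := fun x => max (B + R - ‖x‖) 0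
  have hT : LipschitzWith (0 + 1) T :=
    ((LipschitzWith.const (B + R)).sub lipschitzWith_one_norm).max_const 0
  refine ⟨fun x => max (-T x) (min (g₁ x) (T x)), _, B + R, hT.neg.max (hg₁.min hT),
    fun x hx => ?_, fun x hx => ?_⟩
  · have : T x = 0 := max_eq_right (by linarith)
    simp [this]
  · have hTx : B ≤ T x := le_max_of_le_left (by linarith [hU x hx])
    have h1 := abs_le.1 (hB x hx)
    dsimp only
    rw [← heq hx, min_eq_left (h1.2.trans hTx), max_eq_right (by linarith)]

lemma continuous_of_mem_expSpan {E : Type*} [NormedAddCommGroup E] [InnerProductSpace ℝ E]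
    {e : E → ℝ} (he : e ∈ expSpan E) : Continuous e := by
  induction he using Submodule.span_induction with
  | mem e he =>
    obtain ⟨w, rfl⟩ := he
    dsimp only
    fun_prop
  | zero => exact continuous_zero
  | add e₁ e₂ _ _ h₁ h₂ => exact h₁.add h₂
  | smul c e _ h => exact h.const_smul c

variable {E : Type*} [NormedAddCommGroup E] [InnerProductSpace ℝ E] [FiniteDimensional ℝ E]
  [MeasurableSpace E] [BorelSpace E]

lemma integrable_comp_sub_mul {e g : E → ℝ} (he : Continuous e) (hg : Continuous g)
    (hgs : HasCompactSupport g) (x : E) : Integrable fun z => e (x - z) * g z :=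
  ((he.comp (continuous_const.sub continuous_id)).mul hg).integrable_of_hasCompactSupport
    hgs.mul_left

/-- The convolution of a sum of exponential ridge functions with a compactly supported function is
again such a sum. -/
lemma integral_comp_sub_mul_mem_expSpan {e g : E → ℝ} (he : e ∈ expSpan E) (hg : Continuous g)
    (hgs : HasCompactSupport g) : (fun x => ∫ z, e (x - z) * g z) ∈ expSpan E := by
  induction he using Submodule.span_induction with
  | mem e he =>
    obtain ⟨w, rfl⟩ := he
    -- The factor `exp ⟪w, x⟫` comes out of the integral.
    have : (fun x => ∫ z, Real.exp ⟪w, x - z⟫_ℝ * g z)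
        = (∫ z, Real.exp (-⟪w, z⟫_ℝ) * g z) • fun x => Real.exp ⟪w, x⟫_ℝ := by
      funext x
      rw [Pi.smul_apply, smul_eq_mul, mul_comm, ← integral_const_mul]
      refine integral_congr_ae (Eventually.of_forall fun z => ?_)
      dsimp only
      rw [inner_sub_right, sub_eq_add_neg, Real.exp_add, mul_assoc]
    rw [this]
    exact Submodule.smul_mem _ _ (Submodule.subset_span ⟨w, rfl⟩)
  | zero =>
    simp only [Pi.zero_apply, zero_mul, integral_zero]
    exact Submodule.zero_mem _
  | add e₁ e₂ he₁ he₂ h₁ h₂ =>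
    convert Submodule.add_mem _ h₁ h₂ using 1
    funext x
    rw [Pi.add_apply, ← integral_add
      (integrable_comp_sub_mul (continuous_of_mem_expSpan he₁) hg hgs x)
      (integrable_comp_sub_mul (continuous_of_mem_expSpan he₂) hg hgs x)]
    simp only [Pi.add_apply, add_mul]
  | smul c e _ h =>
    convert Submodule.smul_mem _ c h using 1
    funext x
    rw [Pi.smul_apply, smul_eq_mul, ← integral_const_mul]
    simp only [Pi.smul_apply, smul_eq_mul, mul_assoc]

/-- Averages of a compactly supported Lipschitz function are approximated by sums of exponential
ridge functions in the Lipschitz seminorm. -/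
lemma exists_mem_expSpan_sub_average_lipschitz {g φ : E → ℝ} {C : ℝ≥0} (hg : LipschitzWith C g)
    {R : ℝ} (hgR : ∀ x, R < ‖x‖ → g x = 0) (hφ : Continuous φ) (R₀ : ℝ) {η : ℝ} (hη : 0 < η) :
    ∃ e ∈ expSpan E, ∀ x ∈ closedBall (0 : E) R₀, ∀ y ∈ closedBall (0 : E) R₀,
      |((∫ z, φ z * g (y - z)) - e y) - ((∫ z, φ z * g (x - z)) - e x)| ≤ η * ‖y - x‖ := by
  -- For `x` in the ball of radius `R₀`, only `z` in `B` contribute, so `φ` need only be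
  -- approximated there.
  let B : Set E := closedBall 0 (R₀ + R)
  have hB : IsCompact B := isCompact_closedBall 0 _
  have hgs : HasCompactSupport g := HasCompactSupport.intro (isCompact_closedBall (0 : E) R)
    fun x hx => hgR x (by simpa using hx)
  have hV : 0 < (C + 1) * (volume.real B + 1) := by positivity
  obtain ⟨ψ, hψ, hφψ⟩ := exists_mem_expSpan_near hφ hB (div_pos hη hV)
  have hψc := continuous_of_mem_expSpan hψ
  refine ⟨_, integral_comp_sub_mul_mem_expSpan hψ hg.continuous hgs, fun x hx y hy => ?_⟩
  have hflip : ∀ x, ∫ z, ψ (x - z) * g z = ∫ z, ψ z * g (x - z) := by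
    intro x
    rw [← integral_sub_left_eq_self _ volume x]
    simp only [sub_sub_cancel]
  have hint : ∀ (θ : E → ℝ), Continuous θ → ∀ x, Integrable fun z => θ z * g (x - z) := by
    intro θ hθ x
    have := (integrable_comp_sub_mul hθ hg.continuous hgs x).comp_sub_left x
    simpa only [sub_sub_cancel] using this
  have hsub : ∀ x, Integrable fun z => φ z * g (x - z) - ψ z * g (x - z) := fun x =>
    (hint φ hφ x).sub (hint ψ hψc x)
  have hcomb : ((∫ z, φ z * g (y - z)) - ∫ z, ψ z * g (y - z))
      - ((∫ z, φ z * g (x - z)) - ∫ z, ψ z * g (x - z))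
      = ∫ z, (φ z - ψ z) * (g (y - z) - g (x - z)) := by
    rw [← integral_sub (hint φ hφ y) (hint ψ hψc y), ← integral_sub (hint φ hφ x) (hint ψ hψc x),
      ← integral_sub (hsub y) (hsub x)]
    exact integral_congr_ae (Eventually.of_forall fun z => by dsimp only; ring)
  have hzero : ∀ x ∈ closedBall (0 : E) R₀, ∀ z ∉ B, g (x - z) = 0 := by
    intro x hx z hz
    rw [mem_closedBall_zero_iff] at hx
    rw [mem_closedBall_zero_iff, not_le] at hz
    refine hgR _ ?_
    have := norm_sub_norm_le z x
    rw [norm_sub_rev] at this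
    linarith
  rw [hflip, hflip, hcomb, ← setIntegral_eq_integral_of_forall_compl_eq_zero (s := B)
    (fun z hz => by rw [hzero x hx z hz, hzero y hy z hz, sub_zero, mul_zero]), ← Real.norm_eq_abs]
  have hbound : ∀ z ∈ B, ‖(φ z - ψ z) * (g (y - z) - g (x - z))‖
      ≤ η / ((C + 1) * (volume.real B + 1)) * (C * ‖y - x‖) := by
    intro z hz
    rw [norm_mul]
    refine mul_le_mul (hφψ z hz) ?_ (norm_nonneg _) (by positivity)
    simpa [dist_eq_norm] using hg.dist_le_mul (y - z) (x - z)
  refine (norm_setIntegral_le_of_norm_le_const hB.measure_lt_top hbound).trans ?_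
  have hq : C * volume.real B ≤ (C + 1) * (volume.real B + 1) := by
    have := measureReal_nonneg (μ := (volume : Measure E)) (s := B)
    have := C.coe_nonneg
    nlinarith
  calc η / ((C + 1) * (volume.real B + 1)) * (C * ‖y - x‖) * volume.real B
      = η * ‖y - x‖ * ((C * volume.real B) / ((C + 1) * (volume.real B + 1))) := by ring
    _ ≤ η * ‖y - x‖ * 1 := by
        gcongr
        exact (div_le_one hV).2 hq
    _ = η * ‖y - x‖ := mul_one _

/-- An average of values close to `c` is close to `c`. -/
lemma abs_integral_mul_sub_le {φ G : E → ℝ} {r b c : ℝ} (hφ : Continuous φ) (hφ0 : ∀ z, 0 ≤ φ z)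
    (hφr : ∀ z, r ≤ ‖z‖ → φ z = 0) (hφ1 : ∫ z, φ z = 1) (hG : Continuous G)
    (hGb : ∀ z, ‖z‖ < r → |G z - c| ≤ b) : |(∫ z, φ z * G z) - c| ≤ b := by
  have hs : HasCompactSupport φ := HasCompactSupport.intro (isCompact_closedBall (0 : E) r)
    fun x hx => hφr x (by simpa using hx : r < ‖x‖).le
  have hi : Integrable φ := hφ.integrable_of_hasCompactSupport hs
  have hiG : Integrable fun z => φ z * G z :=
    (hφ.mul hG).integrable_of_hasCompactSupport hs.mul_right
  have h1 : (∫ z, φ z * G z) - c = ∫ z, φ z * (G z - c) := by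
    simp only [mul_sub]
    rw [integral_sub hiG (hi.mul_const c), integral_mul_const, hφ1, one_mul]
  have h2 : b = ∫ z, φ z * b := by rw [integral_mul_const, hφ1, one_mul]
  rw [h1, h2, ← Real.norm_eq_abs]
  refine norm_integral_le_of_norm_le (hi.mul_const b) (Eventually.of_forall fun z => ?_)
  rw [norm_mul, Real.norm_of_nonneg (hφ0 z)]
  rcases lt_or_ge ‖z‖ r with hz | hz
  · exact mul_le_mul_of_nonneg_left (hGb z hz) (hφ0 z)
  · simp [hφr z hz]

end Averages

/-! ### ### Approximation of scalar functions -/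

section Scalar

/-- Scalar functions that are `C^1` on a compact set are approximated by networks, together with
their first order expansions. -/
theorem exists_netSpace_near_scalar {d : ℕ} {σ : ℝ → ℝ} (hσ : IsReluOrLeakyRelu σ)
    {K : Set (EuclideanSpace ℝ (Fin d))} (hK : IsCompact K) {f : EuclideanSpace ℝ (Fin d) → ℝ}
    {f' : EuclideanSpace ℝ (Fin d) → EuclideanSpace ℝ (Fin d) →L[ℝ] ℝ} (hf : IsC1OnWith K f f')
    {ε : ℝ} (hε : 0 < ε) :
    ∃ h ∈ netSpace d ℝ σ, ∀ x ∈ K, |f x - h x| ≤ ε ∧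
      ∀ᶠ y in 𝓝 x, |h y - h x - f' x (y - x)| ≤ ε * ‖y - x‖ := by
  have hfc : ContinuousOn f K := fun x hx => (hf.hasFDerivWithinAt x hx).continuousWithinAt
  -- Tietze extensions: off `K`, `A` need not be the derivative of `φ`.
  obtain ⟨φ, hφ⟩ := ContinuousMap.exists_restrict_eq hK.isClosed ⟨K.domRestrict f, hfc.domRestrict⟩
  obtain ⟨A, hA⟩ := ContinuousMap.exists_restrict_eq hK.isClosed
    ⟨K.domRestrict f', hf.continuousOn.domRestrict⟩
  have hφK : ∀ x ∈ K, φ x = f x := fun x hx => DFunLike.congr_fun hφ ⟨x, hx⟩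
  have hAK : ∀ x ∈ K, A x = f' x := fun x hx => DFunLike.congr_fun hA ⟨x, hx⟩
  have hd : ∀ x ∈ K, HasFDerivWithinAt φ (A x) K x := fun x hx => by
    rw [hAK x hx]
    exact (hf.hasFDerivWithinAt x hx).congr hφK (hφK x hx)
  -- First order budget: `2 * ε₁` from `g`, `ε₁` from the oscillation of `A`, and `η ≤ ε₁` each from
  -- the exponentials and the network.
  obtain ⟨ε₁, hε₁, rfl⟩ : ∃ ε₁ > 0, ε = 5 * ε₁ := ⟨ε / 5, by positivity, by ring⟩
  obtain ⟨δ, hδ, g, hδ1, hgφ, hAosc, hglin⟩ :=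
    exists_locally_almost_linear_near hK φ.continuous A.continuous hd hε₁
  let U := thickening δ K
  have hKU : K ⊆ U := self_subset_thickening hδ K
  have hcomp : IsCompact (cthickening 1 K) := hK.cthickening
  have hUc : U ⊆ cthickening 1 K := thickening_subset_cthickening_of_le hδ1 K
  obtain ⟨B₁, hB₁⟩ := hcomp.exists_bound_of_continuousOn φ.continuous.continuousOn
  obtain ⟨B₂, hB₂⟩ := hcomp.exists_bound_of_continuousOn A.continuous.continuousOn
  obtain ⟨R₁, hR₁pos, hR₁⟩ := hcomp.isBounded.exists_pos_norm_le
  obtain ⟨G, C, R, hG, hGR, hGg⟩ := exists_lipschitzWith_eqOn (U := U) (g := g) (δ := δ)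
    (L := |B₂| + 2 * ε₁) (B := B₁ + ε₁) (R := R₁) hδ (by positivity) (fun x hx => hR₁ x (hUc hx))
    (fun x hx => by
      have h1 := abs_le.1 (hgφ x hx)
      have h2 := abs_le.1 (hB₁ x (hUc hx))
      rw [abs_le]
      constructor <;> linarith)
    (fun x hx y hy hxy => by
      have h1 := abs_le.1 (hglin x hx y hy hxy)
      have h2 : |A x (y - x)| ≤ |B₂| * dist x y := by
        rw [dist_eq_norm', ← Real.norm_eq_abs]
        refine (ContinuousLinearMap.le_opNorm _ _).trans ?_
        gcongr
        exact (hB₂ x (hUc hx)).trans (le_abs_self _)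
      have h3 := abs_le.1 h2
      rw [abs_le]
      constructor <;> linarith)
  -- averaging
  obtain ⟨r, hr, hrδ, hrC⟩ : ∃ r > 0, r ≤ δ / 3 ∧ C * r ≤ ε₁ := by
    refine ⟨min (δ / 3) (ε₁ / (C + 1)), by positivity, min_le_left _ _, ?_⟩
    have hC1 : (0 : ℝ) < C + 1 := by positivity
    calc (C : ℝ) * min (δ / 3) (ε₁ / (C + 1)) ≤ (C + 1) * (ε₁ / (C + 1)) :=
          mul_le_mul (by linarith) (min_le_right _ _) (by positivity) hC1.le
      _ = ε₁ := by field_simp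
  let β : ContDiffBump (0 : EuclideanSpace ℝ (Fin d)) := ⟨r / 2, r, half_pos hr, half_lt_self hr⟩
  let θ : EuclideanSpace ℝ (Fin d) → ℝ := β.normed volume
  have hθc : Continuous θ := β.continuous_normed
  have hθ0 : ∀ z, 0 ≤ θ z := β.nonneg_normed
  have hθ1 : ∫ z, θ z = 1 := β.integral_normed
  have hθr : ∀ z, r ≤ ‖z‖ → θ z = 0 := by
    intro z hz
    rw [← Function.notMem_support, β.support_normed_eq, mem_ball_zero_iff, not_lt]
    exact hz
  let u : EuclideanSpace ℝ (Fin d) → ℝ := fun x => ∫ z, θ z * G (x - z)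
  have hGc : ∀ x, Continuous fun z => G (x - z) := fun x =>
    hG.continuous.comp (continuous_const.sub continuous_id)
  have hu : ∀ x ∈ K, |u x - f x| ≤ 2 * ε₁ := by
    intro x hx
    have h1 : |u x - G x| ≤ ε₁ := by
      refine abs_integral_mul_sub_le hθc hθ0 hθr hθ1 (hGc x) fun z hz => ?_
      have := hG.dist_le_mul (x - z) x
      rw [Real.dist_eq, dist_eq_norm, sub_sub_cancel_left, norm_neg] at this
      exact this.trans ((mul_le_mul_of_nonneg_left hz.le C.coe_nonneg).trans hrC)
    have h2 := abs_le.1 (hgφ x (hKU hx))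
    rw [← hGg x (hKU hx), hφK x hx] at h2
    have h3 := abs_le.1 h1
    rw [abs_le]
    constructor <;> linarith
  have hmemU : ∀ x ∈ K, ∀ y, dist y x < δ → y ∈ U := fun x hx y hy =>
    mem_thickening_iff.2 ⟨x, hx, hy⟩
  have hulin : ∀ x ∈ K, ∀ y, dist y x < δ / 3 →
      |u y - u x - A x (y - x)| ≤ 3 * ε₁ * ‖y - x‖ := by
    intro x hx y hy
    have hθG : ∀ x, Integrable fun z => θ z * G (x - z) := fun x =>
      (hθc.mul (hGc x)).integrable_of_hasCompactSupport β.hasCompactSupport_normed.mul_right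
    have h1 : u y - u x = ∫ z, θ z * (G (y - z) - G (x - z)) := by
      simp only [u, mul_sub]
      rw [integral_sub (hθG y) (hθG x)]
    rw [h1]
    refine abs_integral_mul_sub_le hθc hθ0 hθr hθ1 ((hGc y).sub (hGc x)) fun z hz => ?_
    have hxz : dist (x - z) x < δ / 3 := by
      rw [dist_eq_norm, sub_sub_cancel_left, norm_neg]
      linarith
    have hyz : dist (y - z) (x - z) = dist y x := dist_sub_right y x z
    have hxzU : x - z ∈ U := hmemU x hx _ (by linarith)
    have hyzU : y - z ∈ U := hmemU x hx _ (by linarith [dist_triangle (y - z) (x - z) x])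
    have h2 := hglin _ hxzU _ hyzU (by rw [dist_comm, hyz]; linarith)
    have h3 : |(A (x - z) - A x) (y - x)| ≤ ε₁ * ‖y - x‖ := by
      rw [← Real.norm_eq_abs]
      refine (ContinuousLinearMap.le_opNorm _ _).trans ?_
      gcongr
      exact hAosc x (hKU hx) _ hxzU (by rw [dist_comm]; linarith)
    rw [hGg _ hyzU, hGg _ hxzU]
    rw [sub_sub_sub_cancel_right, dist_sub_right, dist_eq_norm'] at h2
    rw [sub_apply] at h3
    have h4 := abs_le.1 h2
    have h5 := abs_le.1 h3
    rw [abs_le]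
    constructor <;> linarith
  -- approximation by networks
  let R₀ := R₁ + 1
  have hR₀ : 0 < R₀ := by positivity
  obtain ⟨η, hη, hηε, hηR⟩ : ∃ η > 0, η ≤ ε₁ ∧ η * R₀ ≤ ε₁ := by
    refine ⟨min ε₁ (ε₁ / R₀), by positivity, min_le_left _ _, ?_⟩
    rw [← le_div_iff₀ hR₀]
    exact min_le_right _ _
  obtain ⟨e, he, heu⟩ := exists_mem_expSpan_sub_average_lipschitz hG hGR hθc R₀ hη
  obtain ⟨h₀, hh₀, hh₀e⟩ := exists_netSpace_sub_lipschitz_of_mem_expSpan hσ he hR₀ η hη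
  have hh₀u : ∀ x ∈ closedBall (0 : EuclideanSpace ℝ (Fin d)) R₀,
      ∀ y ∈ closedBall (0 : EuclideanSpace ℝ (Fin d)) R₀,
      |(u y - h₀ y) - (u x - h₀ x)| ≤ 2 * η * ‖y - x‖ := by
    intro x hx y hy
    have h1 := abs_le.1 (heu x hx y hy)
    have h2 := abs_le.1 (hh₀e x hx y hy)
    simp only [u]
    rw [abs_le]
    constructor <;> linarith
  have hKR : ∀ x ∈ K, ‖x‖ ≤ R₁ := fun x hx => hR₁ x (hUc (hKU hx))
  -- The Lipschitz seminorm ignores constants; matching values at `0` turns it into a uniform bound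
  -- on the ball.
  refine ⟨h₀ + fun _ => u 0 - h₀ 0, Submodule.add_mem _ hh₀ (const_mem_netSpace σ _),
    fun x hx => ⟨?_, ?_⟩⟩
  · have hxR : x ∈ closedBall (0 : EuclideanSpace ℝ (Fin d)) R₀ := by
      rw [mem_closedBall_zero_iff]
      linarith [hKR x hx]
    have h1 := hh₀u 0 (mem_closedBall_self hR₀.le) x hxR
    rw [sub_zero] at h1
    have h2 : η * ‖x‖ ≤ ε₁ :=
      (mul_le_mul_of_nonneg_left (mem_closedBall_zero_iff.1 hxR) hη.le).trans hηR
    have h3 := abs_le.1 (hu x hx)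
    have h4 := abs_le.1 h1
    simp only [Pi.add_apply]
    rw [abs_le]
    constructor <;> linarith
  · have hδ3 : 0 < min (δ / 3) 1 := by positivity
    filter_upwards [ball_mem_nhds x hδ3] with y hy
    rw [mem_ball] at hy
    have hyx := hy.trans_le (min_le_right _ _)
    have hxR : x ∈ closedBall (0 : EuclideanSpace ℝ (Fin d)) R₀ := by
      rw [mem_closedBall_zero_iff]
      linarith [hKR x hx]
    have hyR : y ∈ closedBall (0 : EuclideanSpace ℝ (Fin d)) R₀ := by
      rw [mem_closedBall_zero_iff]
      rw [dist_eq_norm] at hyx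
      linarith [hKR x hx, norm_sub_norm_le y x]
    have h1 := abs_le.1 (hulin x hx y (hy.trans_le (min_le_left _ _)))
    have h2 := abs_le.1 (hh₀u x hxR y hyR)
    have h3 : η * ‖y - x‖ ≤ ε₁ * ‖y - x‖ := by gcongr
    rw [hAK x hx] at h1
    simp only [Pi.add_apply]
    rw [abs_le]
    constructor <;> linarith

end Scalar

/-! ### ### Vector-valued functions, by coordinates -/

section Vector

/-- Functions that are `C^1` on a compact set are approximated by networks, together with their
first order expansions. -/
theorem exists_shallowNet_near {d : ℕ} {F : Type*} [NormedAddCommGroup F] [NormedSpace ℝ F]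
    [FiniteDimensional ℝ F] {σ : ℝ → ℝ} (hσ : IsReluOrLeakyRelu σ)
    {K : Set (EuclideanSpace ℝ (Fin d))} (hK : IsCompact K) {f : EuclideanSpace ℝ (Fin d) → F}
    {f' : EuclideanSpace ℝ (Fin d) → EuclideanSpace ℝ (Fin d) →L[ℝ] F} (hf : IsC1OnWith K f f')
    {ε : ℝ} (hε : 0 < ε) :
    ∃ N : ShallowNet d F, ∀ x ∈ K, ‖f x - N.eval σ x‖ ≤ ε ∧
      ∀ᶠ y in 𝓝 x, ‖N.eval σ y - N.eval σ x - f' x (y - x)‖ ≤ ε * ‖y - x‖ := by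
  let b := Module.finBasis ℝ F
  let ℓ : Fin (Module.finrank ℝ F) → F →L[ℝ] ℝ := fun i => (b.coord i).toContinuousLinearMap
  have hsum : ∀ v : F, ∑ i, ℓ i v • b i = v := fun v => b.sum_repr v
  let M : ℝ := ∑ i, ‖b i‖
  have hM : 0 < M + 1 := by positivity
  have hcomp : ∀ i, IsC1OnWith K (fun x => ℓ i (f x)) fun x => (ℓ i).comp (f' x) := fun i =>
    ⟨fun x hx => (ℓ i).hasFDerivAt.comp_hasFDerivWithinAt x (hf.hasFDerivWithinAt x hx),
      continuousOn_const.clm_comp hf.continuousOn⟩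
  choose h hnet hh using fun i => exists_netSpace_near_scalar hσ hK (hcomp i) (div_pos hε hM)
  obtain ⟨N, hN⟩ : (fun x => ∑ i, h i x • b i) ∈ netSpace d F σ := by
    have : (fun x => ∑ i, h i x • b i) = ∑ i, fun x => h i x • b i := by
      funext x
      simp [Finset.sum_apply]
    rw [this]
    exact Submodule.sum_mem _ fun i _ => smul_const_mem_netSpace (hnet i) (b i)
  have hbound : ∀ (a : Fin (Module.finrank ℝ F) → ℝ) (c : ℝ), 0 ≤ c →
      (∀ i, |a i| ≤ ε / (M + 1) * c) → ‖∑ i, a i • b i‖ ≤ ε * c := by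
    intro a c hc ha
    calc ‖∑ i, a i • b i‖ ≤ ∑ i, ε / (M + 1) * c * ‖b i‖ :=
          norm_sum_le_of_le _ fun i _ => by
            rw [norm_smul]
            exact mul_le_mul_of_nonneg_right (ha i) (norm_nonneg _)
      _ = ε * c * (M / (M + 1)) := by
          rw [← Finset.mul_sum]
          ring
      _ ≤ ε * c * 1 := by
          gcongr
          exact (div_le_one hM).2 (by linarith)
      _ = ε * c := mul_one _
  have hN' : ∀ x, N.eval σ x = ∑ i, h i x • b i := fun x => congrFun hN x
  refine ⟨N, fun x hx => ⟨?_, ?_⟩⟩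
  · have h1 := hbound (fun i => ℓ i (f x) - h i x) 1 zero_le_one fun i => by
      simpa using (hh i x hx).1
    simpa only [sub_smul, Finset.sum_sub_distrib, hsum, ← hN', mul_one] using h1
  · filter_upwards [eventually_all.2 fun i => (hh i x hx).2] with y hy
    have h1 := hbound (fun i => h i y - h i x - ℓ i (f' x (y - x))) ‖y - x‖ (norm_nonneg _) hy
    simpa only [sub_smul, Finset.sum_sub_distrib, hsum, ← hN'] using h1

end Vector

/-! ### ### Bounds uniform in the exponent, and the conclusion -/

lemma ENNReal.rpow_le_one_add {x : ℝ≥0∞} {q : ℝ} (hq0 : 0 ≤ q) (hq1 : q ≤ 1) : x ^ q ≤ 1 + x := by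
  rcases le_total x 1 with h | h
  · exact (ENNReal.rpow_le_one h hq0).trans le_self_add
  · calc x ^ q ≤ x ^ (1 : ℝ) := ENNReal.rpow_le_rpow_of_exponent_le h hq1
      _ = x := ENNReal.rpow_one x
      _ ≤ 1 + x := le_add_self

lemma ENNReal.inv_toReal_le_one {p : ℝ≥0∞} (hp : 1 ≤ p) : p.toReal⁻¹ ≤ 1 := by
  rcases eq_or_ne p ∞ with rfl | hp'
  · simp
  · exact inv_le_one_of_one_le₀ (by simpa using ENNReal.toReal_mono hp' hp)

/-- A uniform bound on `K` bounds all `L^p` norms with `p ≥ 1`. -/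
lemma eLpNorm_restrict_le_of_ae_bound {α G : Type*} [MeasurableSpace α] {μ : Measure α}
    [NormedAddCommGroup G] {s : Set α} {h : α → G} {C : ℝ} {p : ℝ≥0∞} (hp : 1 ≤ p)
    (hh : ∀ᵐ x ∂μ.restrict s, ‖h x‖ ≤ C) :
    eLpNorm h p (μ.restrict s) ≤ (1 + μ s) * ENNReal.ofReal C := by
  refine (eLpNorm_le_of_ae_bound hh).trans ?_
  rw [Measure.restrict_apply_univ]
  gcongr
  exact ENNReal.rpow_le_one_add (inv_nonneg.2 ENNReal.toReal_nonneg) (ENNReal.inv_toReal_le_one hp)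

theorem theorem1 {d : ℕ} {F : Type*} [NormedAddCommGroup F] [NormedSpace ℝ F]
    [FiniteDimensional ℝ F] (σ : ℝ → ℝ) (hσ : IsReluOrLeakyRelu σ)
    (K : Set (EuclideanSpace ℝ (Fin d))) (hK : IsCompact K)
    (f : EuclideanSpace ℝ (Fin d) → F)
    (f' : EuclideanSpace ℝ (Fin d) → EuclideanSpace ℝ (Fin d) →L[ℝ] F)
    (hf : IsC1OnWith K f f') (ε : ℝ) (hε : 0 < ε) :
    ∃ N : ShallowNet d F,
      (∀ᵐ x ∂(volume : Measure (EuclideanSpace ℝ (Fin d))), DifferentiableAt ℝ (N.eval σ) x) ∧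
      (∀ x ∈ K, ‖f x - N.eval σ x‖ < ε) ∧
      (∀ x ∈ K, DifferentiableAt ℝ (N.eval σ) x → ‖f' x - fderiv ℝ (N.eval σ) x‖ < ε) ∧
      ∀ p : ℝ≥0∞, 1 ≤ p →
        sobolevDist p K f f' (N.eval σ) (fderiv ℝ (N.eval σ)) < ENNReal.ofReal ε := by
  let V : ℝ := 1 + volume.real K
  have hV : 1 ≤ V := le_add_of_nonneg_right measureReal_nonneg
  have hVK : 1 + volume K = ENNReal.ofReal V := by
    rw [ENNReal.ofReal_add zero_le_one measureReal_nonneg, ENNReal.ofReal_one, measureReal_def,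
      ENNReal.ofReal_toReal hK.measure_lt_top.ne]
  -- Each `L^p` norm is then at most `V * ε₁ = ε / 4`, so the two add up to less than `ε`.
  let ε₁ : ℝ := ε / (4 * V)
  have hε₁ : 0 < ε₁ := by positivity
  have hV₁ : V * ε₁ = ε / 4 := by
    simp only [ε₁]
    field_simp
  have hlt : ε₁ < ε := by nlinarith
  obtain ⟨N, hN⟩ := exists_shallowNet_near hσ hK hf hε₁
  obtain ⟨C, hC⟩ := N.exists_lipschitzWith hσ
  have hae : ∀ᵐ x ∂(volume : Measure (EuclideanSpace ℝ (Fin d))),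
      DifferentiableAt ℝ (N.eval σ) x := hC.ae_differentiableAt
  have hder : ∀ x ∈ K, DifferentiableAt ℝ (N.eval σ) x →
      ‖f' x - fderiv ℝ (N.eval σ) x‖ ≤ ε₁ := by
    intro x hx hdiff
    rw [norm_sub_rev]
    -- The network minus the linear map `f' x` has increments from `x` bounded by `ε₁ * ‖y - x‖`,
    -- which bounds its derivative at `x`.
    refine (hdiff.hasFDerivAt.sub (f' x).hasFDerivAt).le_of_lip' hε₁.le ?_
    filter_upwards [(hN x hx).2] with y hy
    convert hy using 2
    simp only [Pi.sub_apply, map_sub]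
    abel
  refine ⟨N, hae, fun x hx => (hN x hx).1.trans_lt hlt,
    fun x hx hdiff => (hder x hx hdiff).trans_lt hlt, fun p hp => ?_⟩
  have hmem : ∀ᵐ x ∂volume.restrict K, x ∈ K := ae_restrict_mem hK.measurableSet
  have h0 := eLpNorm_restrict_le_of_ae_bound (μ := volume) hp (hmem.mono fun x hx => (hN x hx).1)
  have h1 : eLpNorm (fun x => f' x - fderiv ℝ (N.eval σ) x) p (volume.restrict K)
      ≤ (1 + volume K) * ENNReal.ofReal ε₁ := by
    refine eLpNorm_restrict_le_of_ae_bound hp ?_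
    filter_upwards [hmem, ae_restrict_of_ae hae] with x hx hdiff using hder x hx hdiff
  refine (add_le_add h0 h1).trans_lt ?_
  rw [hVK, ← ENNReal.ofReal_mul (zero_le_one.trans hV), hV₁,
    ← ENNReal.ofReal_add (by positivity) (by positivity), ENNReal.ofReal_lt_ofReal_iff hε]
  linarith
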